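/- Let $G$ be a compact abelian group with normalized Haar measure and dual group $\Gamma$, and equip $G^{\mathbb N}$ with the product probability measure. For $k\ge 0$ let $\mathcal F_k$ be the sigma-algebra on $G^{\mathbb N}$ generated by the projection $x\mapsto (x_1,\dots,x_k)$ (so $\mathcal F_0$ is trivial). Let $S$ be a set, $\mathcal H=\ell^2(S)$ with standard orthonormal basis $(e_s)_{s\in S}$, and let $\mathbb N=\{0,1,2,\dots\}$ index the sequences in $\ell^2(\mathbb N,\mathcal H)$. Let $$X=L^1\big(G^{\mathbb N},[(\mathcal F_k)_{k=0}^\infty],\ell^2(\mathbb N,\mathcal H)\big)=\big\{f=(f_k)_{k\ge 0}\in L^1(G^{\mathbb N},\ell^2(\mathbb N,\mathcal H)) : f_k \text{ is } \mathcal F_k\text{-measurable for every } k\big\}$$ with the norm of $L^1(G^{\mathbb N},\ell^2(\mathbb N,\mathcal H))$. For $\gamma=(\gamma_1,\dots,\gamma_k)\in\Gamma^k$ put $\gamma(x)=\gamma_1(x_1)\cdots\gamma_k(x_k)$ and $\widehat{f_k}(\gamma)=\int_{G^{\mathbb N}}\overline{\gamma(x)}f_k(x)\,dx\in\mathcal H$.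 For a family $\lambda=(\lambda^{(k)}_{\gamma,s})_{k\ge 0,\ \gamma\in\Gamma^k,\ s\in S}$ of non-negative real numbers let $\|\lambda\|_{X\to\ell^1}\in[0,\infty]$ be its norm as a Fourier multiplier from $X$ to $\ell^1\big(\bigsqcup_k\Gamma^k\times S\big)$, that is, the smallest constant $A\in[0,\infty]$ such that $$\sum_{k\ge 0}\sum_{\gamma\in\Gamma^k}\sum_{s\in S}\lambda^{(k)}_{\gamma,s}\,\big|\big\langle\widehat{f_k}(\gamma),e_s\big\rangle\big|\le A\,\|f\|_X\qquad\text{for all } f\in X .$$ For $j\ge k$, $\gamma\in\Gamma^k$ and $\gamma'\in\Gamma^{[k+1,j]}$ let $\gamma\otimes\gamma'\in\Gamma^j$ be the concatenation of $\gamma$ and $\gamma'$, and let $$\|\lambda\|_*=\sup_{k\ge 0}\Bigg(\sum_{j\ge k}\sum_{s\in S}\sum_{\gamma'\in\Gamma^{[k+1,j]}}\bigg(\sum_{\gamma\in\Gamma^k}\lambda^{(j)}_{\gamma\otimes\gamma',s}\bigg)^2\Bigg)^{1/2}\in[0,\infty].$$ Then $\|\lambda\|_{X\to\ell^1}$ and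 $\|\lambda\|_*$ are equivalent: there is an absolute constant $0<C<\infty$, independent of $G$, $S$ and $\lambda$, such that $$\|\lambda\|_{X\to\ell^1}\le C\,\|\lambda\|_*\qquad\text{and}\qquad \|\lambda\|_*\le C\,\|\lambda\|_{X\to\ell^1}.$$ In particular, one of the two quantities is finite if and only if the other is. -/

import Mathlib

open MeasureTheory
open scoped ENNReal NNReal

noncomputable section

namespace AdaptedMultiplier

/-- The Hilbert space `ℋ = ℓ²(S)`. -/
abbrev HilbertS (S : Type*) : Type _ := lp (fun _ : S => ℂ) 2

/-- The Hilbert space `ℓ²(ℕ, ℋ)` of square summable sequences in `ℋ = ℓ²(S)`. -/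
abbrev SeqHilbert (S : Type*) : Type _ := lp (fun _ : ℕ => HilbertS S) 2

/-- The countable power `μ^{⊗ℕ}` of a probability measure `μ` on `G`, a measure on `G^ℕ`. The
coordinates of `x ∈ G^ℕ`, usually written `x₁, x₂, …`, are `x 0, x 1, …` here. -/
abbrev powMeasure {G : Type*} [MeasurableSpace G] (μ : Measure G) [IsProbabilityMeasure μ] :
    Measure (ℕ → G) :=
  Measure.infinitePi (fun _ : ℕ => μ)

/-- The canonical filtration on `G^ℕ`: the sigma-algebra `𝓕 k` is generated by the projection onto
the first `k` coordinates; in particular `𝓕 0` is trivial. -/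
def coordFiltration (G : Type*) [MeasurableSpace G] :
    Filtration ℕ (MeasurableSpace.pi : MeasurableSpace (ℕ → G)) where
  seq k := MeasurableSpace.comap (fun (x : ℕ → G) (i : Fin k) => x i) MeasurableSpace.pi
  mono' := by
    intro k l hkl
    have h : (fun (x : ℕ → G) (i : Fin k) => x i)
        = (fun (y : Fin l → G) (i : Fin k) => y (Fin.castLE hkl i))
          ∘ (fun (x : ℕ → G) (i : Fin l) => x i) := rfl
    change MeasurableSpace.comap (fun (x : ℕ → G) (i : Fin k) => x i) MeasurableSpace.pi ≤ _
    rw [h, ← MeasurableSpace.comap_comp]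
    apply MeasurableSpace.comap_mono
    exact (measurable_pi_lambda _ fun i => measurable_pi_apply _).comap_le
  le' := by
    intro k
    exact (measurable_pi_lambda _ fun i => measurable_pi_apply _).comap_le

/-- The space `L¹(G^ℕ, [(𝓕 k)], ℓ²(ℕ, ℋ))` of adapted sequences: all `f ∈ L¹(G^ℕ, ℓ²(ℕ, ℋ))`
such that for every `k` the `k`-th component `f_k` is `𝓕 k`-measurable (has an
`𝓕 k`-measurable representative, as elements of `L¹` are classes of functions). -/
def adaptedL1 {G : Type*} [MeasurableSpace G] (μ : Measure G) [IsProbabilityMeasure μ]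
    (S : Type*) : Submodule ℂ (Lp (SeqHilbert S) 1 (powMeasure μ)) where
  carrier := {f | ∀ k : ℕ, AEStronglyMeasurable[coordFiltration G k]
    (fun x => (f x : ℕ → HilbertS S) k) (powMeasure μ)}
  zero_mem' := by
    intro k
    refine (aestronglyMeasurable_const (b := (0 : HilbertS S))).congr ?_
    filter_upwards [Lp.coeFn_zero (SeqHilbert S) 1 (powMeasure μ)] with x hx
    rw [hx]
    rfl
  add_mem' := by
    intro f g hf hg k
    refine ((hf k).add (hg k)).congr ?_
    filter_upwards [Lp.coeFn_add f g] with x hx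
    rw [hx]
    rfl
  smul_mem' := by
    intro c f hf k
    refine ((hf k).const_smul c).congr ?_
    filter_upwards [Lp.coeFn_smul c f] with x hx
    rw [hx]
    rfl

/-- For `γ = (γ₁, …, γ_k) ∈ Γ^k`, the character `x ↦ γ₁(x₁) ⋯ γ_k(x_k)` on `G^ℕ`. -/
def charFun {G : Type*} [CommGroup G] [TopologicalSpace G] {k : ℕ}
    (γ : Fin k → PontryaginDual G) (x : ℕ → G) : ℂ :=
  ∏ i : Fin k, ((γ i (x i) : Circle) : ℂ)

/-- The Fourier coefficient `∫ conj(γ(x)) f_k(x) dx ∈ ℋ` of the `k`-th component of `f` at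
`γ ∈ Γ^k`. -/
def fourierCoeff {G : Type*} [CommGroup G] [TopologicalSpace G] [MeasurableSpace G]
    {μ : Measure G} [IsProbabilityMeasure μ] {S : Type*}
    (f : Lp (SeqHilbert S) 1 (powMeasure μ)) (k : ℕ) (γ : Fin k → PontryaginDual G) :
    HilbertS S :=
  ∫ x, (starRingEnd ℂ (charFun γ x)) • (f x : ℕ → HilbertS S) k ∂(powMeasure μ)

/-- The `ℓ¹(⨆_k Γ^k × S)` norm of the sequence `lam^{(k)}_{γ,s} ⟨f̂_k(γ), e_s⟩`. -/
def multiplierSum {G : Type*} [CommGroup G] [TopologicalSpace G] [MeasurableSpace G]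
    {μ : Measure G} [IsProbabilityMeasure μ] {S : Type*}
    (lam : (k : ℕ) → (Fin k → PontryaginDual G) → S → ℝ≥0)
    (f : Lp (SeqHilbert S) 1 (powMeasure μ)) : ℝ≥0∞ :=
  ∑' p : (Σ k : ℕ, (Fin k → PontryaginDual G) × S),
    (lam p.1 p.2.1 p.2.2 : ℝ≥0∞) * ‖(fourierCoeff f p.1 p.2.1 : S → ℂ) p.2.2‖ₑ

/-- The norm of `lam` as a Fourier multiplier from the space of adapted sequences to `ℓ¹`: the
best constant `A ∈ [0, ∞]` in `∑ lam |⟨f̂_k(γ), e_s⟩| ≤ A ‖f‖`. -/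
def multiplierNorm {G : Type*} [CommGroup G] [TopologicalSpace G] [MeasurableSpace G]
    (μ : Measure G) [IsProbabilityMeasure μ] {S : Type*}
    (lam : (k : ℕ) → (Fin k → PontryaginDual G) → S → ℝ≥0) : ℝ≥0∞ :=
  sInf {A : ℝ≥0∞ | ∀ f ∈ adaptedL1 μ S, multiplierSum lam f ≤ A * ‖f‖ₑ}

/-- The quantity
`sup_k (∑_{j ≥ k} ∑_s ∑_{γ' ∈ Γ^{[k+1,j]}} (∑_{γ ∈ Γ^k} lam^{(j)}_{γ ⊗ γ', s})²)^{1/2}`.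
Here `j = k + m` with `m ≥ 0`, a tuple `γ'` indexed by `[k+1, j]` is a tuple of length `m`, and
`γ ⊗ γ'` is the concatenation of `γ` and `γ'`. -/
def adaptedNorm {G : Type*} [CommGroup G] [TopologicalSpace G] {S : Type*}
    (lam : (k : ℕ) → (Fin k → PontryaginDual G) → S → ℝ≥0) : ℝ≥0∞ :=
  ⨆ k : ℕ, (∑' m : ℕ, ∑' s : S, ∑' γ' : Fin m → PontryaginDual G,
    (∑' γ : Fin k → PontryaginDual G, (lam (k + m) (Fin.append γ γ') s : ℝ≥0∞)) ^ 2)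
      ^ (1 / 2 : ℝ)

end AdaptedMultiplier

end

universe u v

/-!
Both inequalities hold with constant `2`, and both rest on splitting a point of `G^ℕ` into its first
`k` coordinates `x` and the remaining sequence `y`, which are independent
(`measurePreserving_paste`), and on orthogonality of characters in `y` (`lintegral_enorm_sq_sum_smul`).

*Multiplier norm at most twice the adapted norm.* After multiplying `lam` by suitable phases, a
finite part of the multiplier sum of `f` is `∫ ∑ φ_k f_k`, where `φ_k` is a trigonometric polynomial
on `G^k` with coefficients of modulus at most `lam`. This is a pairing of the kind that occurs in
`H¹`–`BMO` duality, and Herz's and Garsia's argument bounds it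
(`lintegral_sum_sum_mul_le`): let `R_k = (∑_{j < k} |f_j|²)^{1/2}`, put the weight `R_{k+1}` into the
inequality `|φ_k f_k| ≤ (c |f_k|² / R_{k+1} + |φ_k|² R_{k+1} / c) / 2`, observe that
`|f_k|² / R_{k+1} ≤ 2 (R_{k+1} - R_k)` telescopes, and sum the second term by parts. What remains is
to bound the mean of `(R_{i+1} - R_i) ∑_{k ≥ i} |φ_k|²`. Here `R_{i+1} - R_i` depends on the first
`i` coordinates only; by Parseval in the remaining ones, the integral of `∑_{k ≥ i} |φ_k|²` is at
most the `i`-th term of the supremum `(adaptedNorm lam)²`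
(`lintegral_enorm_sq_trigPoly_paste_le`, `sum_sq_le_of_adaptedNorm_le`). As `lam` is non-negative,
the phases and the values of the characters at `x` only decrease the inner sums.

*Adapted norm at most twice the multiplier norm.* For fixed `k`, the inequality is tested on
`D(x) ∑_q l_q γ'_q(y) e_q`, where `D` is an approximate unit on `G^k`
(`exists_approximate_unit`). The `L¹` norm factors, and that of the second factor is at most its `L²`
norm `(∑ l_q²)^{1/2}`. The coefficient at `γ ⊗ γ'_q` is `D̂(γ) l_q` with `|D̂(γ)| ≥ 1 / 2`, so the
choice of `l_q` as the sum of `lam` over `γ ⊗ γ'_q` gives the claim for finite sums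
(`sum_sq_le_of_multiplierSum_le`).
-/

namespace AdaptedMultiplier

/-! ### Splitting the infinite product after finitely many coordinates -/

/-- The sequence whose first `k` terms are those of `x`, followed by the whole sequence `y`. -/
def paste {G : Type*} (k : ℕ) (x y : ℕ → G) : ℕ → G :=
  fun n => if n < k then x n else y (n - k)

lemma measurable_paste {G : Type*} [MeasurableSpace G] (k : ℕ) :
    Measurable (fun p : (ℕ → G) × (ℕ → G) => paste k p.1 p.2) := by
  refine measurable_pi_lambda _ fun n => ?_
  by_cases h : n < k
  · simp only [paste, h, if_true]; fun_prop
  · simp only [paste, h, if_false]; fun_prop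

lemma paste_apply_lt {G : Type*} {k n : ℕ} (h : n < k) (x y : ℕ → G) : paste k x y n = x n :=
  if_pos h

lemma paste_apply_add {G : Type*} (k n : ℕ) (x y : ℕ → G) : paste k x y (k + n) = y n := by
  simp [paste]

/-- If `x` and `y` are independent with law `μ^{⊗ℕ}`, then `paste k x y` has law `μ^{⊗ℕ}`. -/
lemma measurePreserving_paste {G : Type*} [MeasurableSpace G] (μ : Measure G)
    [IsProbabilityMeasure μ] (k : ℕ) :
    MeasurePreserving (fun p : (ℕ → G) × (ℕ → G) => paste k p.1 p.2)
      ((powMeasure μ).prod (powMeasure μ)) (powMeasure μ) := by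
  refine ⟨measurable_paste k, Measure.eq_infinitePi _ fun s t ht => ?_⟩
  rw [Measure.map_apply (measurable_paste k) (.pi s.countable_toSet fun i _ => ht i)]
  have hset : (fun p : (ℕ → G) × (ℕ → G) => paste k p.1 p.2) ⁻¹' (Set.pi s t)
      = (Set.pi (s.filter (· < k) : Finset ℕ) t) ×ˢ
        (Set.pi ((s.filter (¬ · < k)).image (· - k) : Finset ℕ) fun n => t (n + k)) := by
    ext ⟨x, y⟩
    simp only [Set.mem_preimage, Set.mem_pi, Set.mem_prod, Finset.mem_coe, Finset.mem_filter,
      Finset.mem_image]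
    constructor
    · intro h
      refine ⟨fun i hi => ?_, ?_⟩
      · simpa [paste, hi.2] using h i hi.1
      · rintro i ⟨j, ⟨hj, hjk⟩, rfl⟩
        simpa [paste, hjk, Nat.sub_add_cancel (not_lt.1 hjk)] using h j hj
    · rintro ⟨h1, h2⟩ i hi
      by_cases hik : i < k
      · simpa [paste, hik] using h1 i ⟨hi, hik⟩
      · simpa [paste, hik, Nat.sub_add_cancel (not_lt.1 hik)] using
          h2 (i - k) ⟨i, ⟨hi, hik⟩, rfl⟩
  rw [hset, Measure.prod_prod, Measure.infinitePi_pi _ fun i _ => ht i,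
    Measure.infinitePi_pi _ fun i _ => ht _, Finset.prod_image,
    ← Finset.prod_filter_mul_prod_filter_not s (· < k)]
  · congr 1
    refine Finset.prod_congr rfl fun i hi => ?_
    rw [Nat.sub_add_cancel (not_lt.1 (Finset.mem_filter.1 hi).2)]
  · intro i hi j hj h
    have h1 := (Finset.mem_filter.1 hi).2
    have h2 := (Finset.mem_filter.1 hj).2
    simp only at h
    omega

lemma lintegral_eq_lintegral_lintegral_paste {G : Type*} [MeasurableSpace G] (μ : Measure G)
    [IsProbabilityMeasure μ] (k : ℕ) {F : (ℕ → G) → ℝ≥0∞} (hF : Measurable F) :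
    ∫⁻ z, F z ∂powMeasure μ
      = ∫⁻ x, ∫⁻ y, F (paste k x y) ∂powMeasure μ ∂powMeasure μ := by
  rw [← (measurePreserving_paste μ k).lintegral_comp hF]
  exact lintegral_prod _ (hF.comp (measurable_paste k)).aemeasurable

lemma integral_eq_integral_integral_paste {G : Type*} [MeasurableSpace G] (μ : Measure G)
    [IsProbabilityMeasure μ] (k : ℕ) {F : (ℕ → G) → ℂ} (hF : Integrable F (powMeasure μ)) :
    ∫ z, F z ∂powMeasure μ
      = ∫ x, ∫ y, F (paste k x y) ∂powMeasure μ ∂powMeasure μ := by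
  have hmp := measurePreserving_paste μ k
  rw [← hmp.map_eq, integral_map hmp.measurable.aemeasurable
    (hmp.map_eq.symm ▸ hF.aestronglyMeasurable)]
  refine (integral_prod (f := fun p : (ℕ → G) × (ℕ → G) => F (paste k p.1 p.2)) ?_).trans ?_
  · exact hmp.integrable_comp_of_integrable hF
  · rw [hmp.map_eq]

/-- A function measurable with respect to the first `k` coordinates does not see the sequence
pasted behind them. -/
lemma apply_paste_of_measurable {G Z : Type*} [MeasurableSpace G] [MeasurableSpace Z]
    [MeasurableSingletonClass Z] {k : ℕ} {w : (ℕ → G) → Z}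
    (hw : Measurable[coordFiltration G k] w) (x y : ℕ → G) : w (paste k x y) = w x :=
  Measurable.factorsThrough (f := fun (x : ℕ → G) (i : Fin k) => x i) hw
    (funext fun i => paste_apply_lt i.2 x y)

/-! ### Characters and the Parseval identity -/

section Characters

variable {G : Type*} [CommGroup G] [TopologicalSpace G]

lemma charFun_append_paste {k m : ℕ} (γ : Fin k → PontryaginDual G) (γ' : Fin m → PontryaginDual G)
    (x y : ℕ → G) : charFun (Fin.append γ γ') (paste k x y) = charFun γ x * charFun γ' y := by
  simp only [charFun, Fin.prod_univ_add, Fin.append_left, Fin.append_right, Fin.val_castAdd,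
    Fin.val_natAdd, paste_apply_add]
  congr 1
  exact Finset.prod_congr rfl fun i _ => by rw [paste_apply_lt i.2]

@[simp]
lemma norm_charFun {k : ℕ} (γ : Fin k → PontryaginDual G) (x : ℕ → G) : ‖charFun γ x‖ = 1 := by
  rw [charFun, norm_prod]
  exact Finset.prod_eq_one fun i _ => Circle.norm_coe _

variable [MeasurableSpace G] [BorelSpace G]

lemma measurable_character (χ : PontryaginDual G) : Measurable (fun g => ((χ g : Circle) : ℂ)) :=
  (continuous_subtype_val.comp (map_continuous χ)).measurable

lemma measurable_coordFiltration_charFun {k : ℕ} (γ : Fin k → PontryaginDual G) :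
    Measurable[coordFiltration G k] (charFun γ) := by
  have h : Measurable fun y : Fin k → G => ∏ i, ((γ i (y i) : Circle) : ℂ) :=
    Finset.measurable_prod _ fun i _ => (measurable_character (γ i)).comp (measurable_pi_apply i)
  exact h.comp (comap_measurable (fun (x : ℕ → G) (i : Fin k) => x i))

lemma measurable_charFun {k : ℕ} (γ : Fin k → PontryaginDual G) : Measurable (charFun γ) :=
  (measurable_coordFiltration_charFun γ).mono ((coordFiltration G).le k) le_rfl

variable [IsTopologicalGroup G]

/-- Translating one coordinate by `g` multiplies the integral of `conj γ · γ'` by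
`conj γ_j(g) γ'_j(g)`; so the integral vanishes unless `γ = γ'`. -/
lemma integral_conj_charFun_mul_charFun (μ : Measure G) [μ.IsHaarMeasure] [IsProbabilityMeasure μ]
    {k : ℕ} {γ γ' : Fin k → PontryaginDual G} (h : γ ≠ γ') :
    ∫ x, starRingEnd ℂ (charFun γ x) * charFun γ' x ∂powMeasure μ = 0 := by
  obtain ⟨j, hj⟩ := Function.ne_iff.1 h
  obtain ⟨g, hg⟩ : ∃ g, γ j g ≠ γ' j g := by
    by_contra! hcon
    exact hj (PontryaginDual.ext hcon)
  set T : (ℕ → G) → ℕ → G := fun x n => (if n = (j : ℕ) then g else 1) * x n with hT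
  have hTm : ∀ n : ℕ, Measurable (fun a : G => (if n = (j : ℕ) then g else 1) * a) :=
    fun n => measurable_const_mul _
  have hTp : MeasurePreserving T (powMeasure μ) (powMeasure μ) := by
    refine ⟨measurable_pi_lambda _ fun n => (hTm n).comp (measurable_pi_apply n), ?_⟩
    have := Measure.infinitePi_map_pi (μ := fun _ : ℕ => μ) hTm
    simp only [map_mul_left_eq_self] at this
    exact this
  have hchar : ∀ (δ : Fin k → PontryaginDual G) x,
      charFun δ (T x) = ((δ j g : Circle) : ℂ) * charFun δ x := by
    intro δ x
    simp only [charFun, hT, map_mul, Circle.coe_mul, Finset.prod_mul_distrib]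
    congr 1
    rw [Finset.prod_eq_single j]
    · simp
    · intro b _ hb
      simp [Fin.val_ne_of_ne hb]
    · simp
  have hmeas : Measurable fun x => starRingEnd ℂ (charFun γ x) * charFun γ' x :=
    (Complex.continuous_conj.measurable.comp (measurable_charFun γ)).mul (measurable_charFun γ')
  set I := ∫ x, starRingEnd ℂ (charFun γ x) * charFun γ' x ∂powMeasure μ with hI
  set z : ℂ := starRingEnd ℂ ((γ j g : Circle) : ℂ) * ((γ' j g : Circle) : ℂ) with hz
  have key : I = z * I := by
    conv_lhs => rw [hI, ← hTp.map_eq, integral_map hTp.measurable.aemeasurable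
      hmeas.aestronglyMeasurable]
    rw [hI, ← integral_const_mul]
    refine integral_congr_ae (.of_forall fun x => ?_)
    simp only [hchar, map_mul, hz]
    ring
  have hz1 : z ≠ 1 := by
    intro h1
    apply hg
    apply Circle.ext
    have h2 : ((γ j g : Circle) : ℂ) * z = ((γ' j g : Circle) : ℂ) := by
      rw [hz, ← mul_assoc, Complex.mul_conj]
      simp
    rw [← h2, h1, mul_one]
  have : (1 - z) * I = 0 := by rw [sub_mul, one_mul, ← key, sub_self]
  exact (mul_eq_zero.1 this).resolve_left (sub_ne_zero.2 hz1.symm)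

end Characters

/-- Parseval's identity for finitely many unimodular functions `χ q` with vector coefficients
`v q`: two different indices need an orthogonal pair of functions or of vectors. -/
lemma lintegral_enorm_sq_sum_smul {Ω H ι : Type*} [MeasurableSpace Ω] (ν : Measure Ω)
    [IsProbabilityMeasure ν] [NormedAddCommGroup H] [InnerProductSpace ℂ H] (Q : Finset ι)
    {χ : ι → Ω → ℂ} (hχm : ∀ q, Measurable (χ q)) (hχ : ∀ q x, ‖χ q x‖ = 1) (v : ι → H)
    (hort : ∀ q ∈ Q, ∀ q' ∈ Q, q ≠ q' →
      inner ℂ (v q) (v q') = 0 ∨ ∫ x, starRingEnd ℂ (χ q x) * χ q' x ∂ν = 0) :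
    ∫⁻ x, ‖∑ q ∈ Q, χ q x • v q‖ₑ ^ 2 ∂ν = ∑ q ∈ Q, ‖v q‖ₑ ^ 2 := by
  have hmeas : ∀ q q', Measurable fun x => starRingEnd ℂ (χ q x) * χ q' x := fun q q' =>
    (Complex.continuous_conj.measurable.comp (hχm q)).mul (hχm q')
  have hint : ∀ q q', Integrable (fun x => starRingEnd ℂ (χ q x) * χ q' x * inner ℂ (v q) (v q'))
      ν := fun q q' =>
    (Integrable.of_bound (hmeas q q').aestronglyMeasurable 1
      (.of_forall fun x => by simp [hχ])).mul_const _
  have hexp : ∀ x, ((‖∑ q ∈ Q, χ q x • v q‖ ^ 2 : ℝ) : ℂ)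
      = ∑ q ∈ Q, ∑ q' ∈ Q, starRingEnd ℂ (χ q x) * χ q' x * inner ℂ (v q) (v q') := by
    intro x
    have h1 := inner_self_eq_norm_sq_to_K (𝕜 := ℂ) (∑ q ∈ Q, χ q x • v q)
    push_cast
    refine Eq.trans h1.symm ?_
    rw [sum_inner]
    refine Finset.sum_congr rfl fun q _ => ?_
    rw [inner_sum]
    refine Finset.sum_congr rfl fun q' _ => ?_
    rw [inner_smul_left, inner_smul_right, mul_assoc]
  have hcomplex : ((∫ x, ‖∑ q ∈ Q, χ q x • v q‖ ^ 2 ∂ν : ℝ) : ℂ) = ∑ q ∈ Q, (‖v q‖ ^ 2 : ℝ) := by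
    rw [← integral_complex_ofReal]
    simp_rw [hexp]
    rw [integral_finsetSum _ fun q _ => integrable_finsetSum _ fun q' _ => hint q q']
    rw [Complex.ofReal_sum]
    refine Finset.sum_congr rfl fun q hq => ?_
    rw [integral_finsetSum _ fun q' _ => hint q q', Finset.sum_eq_single_of_mem q hq]
    · have : ∀ x, starRingEnd ℂ (χ q x) * χ q x = 1 := fun x => by
        rw [mul_comm, Complex.mul_conj, Complex.normSq_eq_norm_sq, hχ]; simp
      simp only [this, one_mul, integral_const, probReal_univ, one_smul]
      rw [inner_self_eq_norm_sq_to_K]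
      push_cast
      rfl
    · intro q' hq' hne
      rw [integral_mul_const]
      rcases hort q hq q' hq' hne.symm with h | h <;> simp [h]
  have hreal : ∫ x, ‖∑ q ∈ Q, χ q x • v q‖ ^ 2 ∂ν = ∑ q ∈ Q, ‖v q‖ ^ 2 := by
    apply Complex.ofReal_injective
    rw [hcomplex]
  have hi : Integrable (fun x => ‖∑ q ∈ Q, χ q x • v q‖ ^ 2) ν := by
    have := (integrable_finsetSum Q fun q _ => integrable_finsetSum Q fun q' _ => hint q q').re
    refine this.congr (.of_forall fun x => ?_)
    simp only
    rw [← hexp x]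
    exact Complex.ofReal_re _
  calc ∫⁻ x, ‖∑ q ∈ Q, χ q x • v q‖ₑ ^ 2 ∂ν
      = ∫⁻ x, ENNReal.ofReal (‖∑ q ∈ Q, χ q x • v q‖ ^ 2) ∂ν := by
        refine lintegral_congr fun x => ?_
        rw [ENNReal.ofReal_pow (norm_nonneg _), ofReal_norm]
    _ = ENNReal.ofReal (∑ q ∈ Q, ‖v q‖ ^ 2) := by
        rw [← ofReal_integral_eq_lintegral_ofReal hi (.of_forall fun x => by positivity), hreal]
    _ = _ := by
        rw [ENNReal.ofReal_sum_of_nonneg fun q _ => by positivity]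
        refine Finset.sum_congr rfl fun q _ => ?_
        rw [ENNReal.ofReal_pow (norm_nonneg _), ofReal_norm]

/-! ### The Garsia–Herz inequality -/

/-- The weighted Cauchy–Schwarz step: the weight `R`, the square function after the current term,
makes `∑ t² / R` telescope, since `R² - R₀² ≤ 2 R (R - R₀)`. -/
lemma sum_mul_le_sub_add {ι : Type*} (Q : Finset ι) (a t : ι → ℝ) {b c R R₀ : ℝ}
    (hc : 0 < c) (hR : 0 ≤ R) (hR₀ : 0 ≤ R₀) (hle : R₀ ≤ R) (hsq : R ^ 2 = R₀ ^ 2 + b ^ 2)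
    (ht : ∑ q ∈ Q, t q ^ 2 ≤ b ^ 2) :
    ∑ q ∈ Q, a q * t q ≤ c * (R - R₀) + (∑ q ∈ Q, a q ^ 2) * R / (2 * c) := by
  rcases hR.eq_or_lt with h0 | hpos
  · have hb : b ^ 2 ≤ 0 := by nlinarith [sq_nonneg R₀]
    have hz : ∀ q ∈ Q, t q = 0 := fun q hq => by
      have h1 := Finset.single_le_sum (f := fun q => t q ^ 2) (fun q _ => sq_nonneg (t q)) hq
      have h2 : t q ^ 2 ≤ 0 := h1.trans (ht.trans hb)
      exact pow_eq_zero_iff two_ne_zero |>.1 (le_antisymm h2 (sq_nonneg _))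
    rw [Finset.sum_eq_zero fun q hq => by rw [hz q hq, mul_zero]]
    have : R₀ = 0 := le_antisymm (hle.trans h0.symm.le) hR₀
    rw [← h0, this]
    simp
  · have h1 : ∑ q ∈ Q, a q * t q
        ≤ ∑ q ∈ Q, (c / (2 * R) * t q ^ 2 + R / (2 * c) * a q ^ 2) := by
      refine Finset.sum_le_sum fun q _ => ?_
      have h2 : c / (2 * R) * t q ^ 2 + R / (2 * c) * a q ^ 2 - a q * t q
          = (c * t q - R * a q) ^ 2 / (2 * c * R) := by
        field_simp
        ring
      have h3 : 0 ≤ (c * t q - R * a q) ^ 2 / (2 * c * R) := by positivity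
      linarith
    rw [Finset.sum_add_distrib, ← Finset.mul_sum, ← Finset.mul_sum] at h1
    have h4 : c / (2 * R) * ∑ q ∈ Q, t q ^ 2 ≤ c * (R - R₀) := by
      calc c / (2 * R) * ∑ q ∈ Q, t q ^ 2 ≤ c / (2 * R) * (2 * R * (R - R₀)) := by
            gcongr
            nlinarith
        _ = c * (R - R₀) := by field_simp
    calc _ ≤ _ := h1
      _ ≤ c * (R - R₀) + R / (2 * c) * ∑ q ∈ Q, a q ^ 2 := by gcongr
      _ = _ := by ring

/-- The square function of the first `k` terms of `b`. -/
noncomputable def squareFn {Ω : Type*} (b : ℕ → Ω → ℝ) (k : ℕ) (x : Ω) : ℝ :=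
  √(∑ j ∈ Finset.range k, b j x ^ 2)

section SquareFn

variable {Ω : Type*} (b : ℕ → Ω → ℝ)

@[simp]
lemma squareFn_zero (x : Ω) : squareFn b 0 x = 0 := by simp [squareFn]

lemma squareFn_nonneg (k : ℕ) (x : Ω) : 0 ≤ squareFn b k x := Real.sqrt_nonneg _

lemma squareFn_succ_sq (k : ℕ) (x : Ω) :
    squareFn b (k + 1) x ^ 2 = squareFn b k x ^ 2 + b k x ^ 2 := by
  rw [squareFn, squareFn, Real.sq_sqrt (Finset.sum_nonneg fun j _ => sq_nonneg _),
    Real.sq_sqrt (Finset.sum_nonneg fun j _ => sq_nonneg _), Finset.sum_range_succ]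

lemma squareFn_le_succ (k : ℕ) (x : Ω) : squareFn b k x ≤ squareFn b (k + 1) x := by
  refine Real.sqrt_le_sqrt ?_
  rw [Finset.sum_range_succ]
  exact le_add_of_nonneg_right (sq_nonneg _)

lemma ofReal_squareFn (k : ℕ) (x : Ω) : ENNReal.ofReal (squareFn b k x)
    = ∑ i ∈ Finset.range k, ENNReal.ofReal (squareFn b (i + 1) x - squareFn b i x) := by
  rw [← ENNReal.ofReal_sum_of_nonneg fun i _ => sub_nonneg.2 (squareFn_le_succ b i x),
    Finset.sum_range_sub fun i => squareFn b i x, squareFn_zero, sub_zero]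

lemma measurable_squareFn {m : MeasurableSpace Ω} {b : ℕ → Ω → ℝ} {k : ℕ}
    (hb : ∀ j < k, Measurable (b j)) : Measurable (squareFn b k) := by
  have h : Measurable fun x => ∑ j ∈ Finset.range k, b j x ^ 2 :=
    Finset.measurable_sum _ fun j hj => (hb j (Finset.mem_range.1 hj)).pow_const 2
  exact h.sqrt

/-- Summation by parts: a bound for the tails `∑_{i ≤ k < N} A k` against each increment of the
square function bounds the sum of the `A k` weighted by the square function. -/
lemma lintegral_sum_mul_squareFn_le [MeasurableSpace Ω] (ν : Measure Ω) {b : ℕ → Ω → ℝ}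
    (hb : ∀ j, Measurable (b j)) {A : ℕ → Ω → ℝ≥0∞} (hA : ∀ k, Measurable (A k)) (N : ℕ)
    (B : ℝ≥0∞)
    (htail : ∀ i < N, ∫⁻ x, ENNReal.ofReal (squareFn b (i + 1) x - squareFn b i x) *
        ∑ m ∈ Finset.range (N - i), A (i + m) x ∂ν
      ≤ B * ∫⁻ x, ENNReal.ofReal (squareFn b (i + 1) x - squareFn b i x) ∂ν) :
    ∫⁻ x, ∑ k ∈ Finset.range N, A k x * ENNReal.ofReal (squareFn b (k + 1) x) ∂ν
      ≤ B * ∫⁻ x, ENNReal.ofReal (squareFn b N x) ∂ν := by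
  have hS : ∀ k, Measurable (squareFn b k) := fun k => measurable_squareFn fun j _ => hb j
  have hD : ∀ i, Measurable fun x =>
      ENNReal.ofReal (squareFn b (i + 1) x - squareFn b i x) :=
    fun i => ((hS _).sub (hS _)).ennreal_ofReal
  have hrw : ∀ x, ∑ k ∈ Finset.range N, A k x * ENNReal.ofReal (squareFn b (k + 1) x)
      = ∑ i ∈ Finset.range N, ENNReal.ofReal (squareFn b (i + 1) x - squareFn b i x) *
        ∑ m ∈ Finset.range (N - i), A (i + m) x := by
    intro x
    simp_rw [ofReal_squareFn, Finset.mul_sum]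
    have : ∀ i ∈ Finset.range N, ∑ m ∈ Finset.range (N - i),
        ENNReal.ofReal (squareFn b (i + 1) x - squareFn b i x) * A (i + m) x
        = ∑ k ∈ Finset.Ico i N,
          ENNReal.ofReal (squareFn b (i + 1) x - squareFn b i x) * A k x := fun i _ => by
      rw [Finset.sum_Ico_eq_sum_range]
    rw [Finset.sum_congr rfl this]
    rw [Finset.sum_comm' (t' := Finset.range N) (s' := fun i => Finset.Ico i N)]
    · exact Finset.sum_congr rfl fun i _ => Finset.sum_congr rfl fun k _ => mul_comm _ _
    · intro k i
      simp only [Finset.mem_range, Finset.mem_Ico]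
      omega
  simp_rw [hrw, ofReal_squareFn b N]
  rw [lintegral_finsetSum, lintegral_finsetSum _ fun i _ => hD i, Finset.mul_sum]
  · exact Finset.sum_le_sum fun i hi => htail i (Finset.mem_range.1 hi)
  · exact fun i _ => (hD i).mul (Finset.measurable_sum _ fun m _ => hA _)

/-- The Garsia–Herz form of `H¹`–`BMO` duality: pointwise products `a k q · t k q` are controlled
by the square function of `b`, if `∑_q (t k q)² ≤ (b k)²` and the tails of `∑_q (a k q)²` are
bounded in mean against the increments of the square function. -/
lemma lintegral_sum_sum_mul_le [MeasurableSpace Ω] (ν : Measure Ω) {ι : Type*} (Q : Finset ι)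
    {b : ℕ → Ω → ℝ} (hb : ∀ j, Measurable (b j)) {a t : ℕ → ι → Ω → ℝ}
    (ha : ∀ k q, Measurable (a k q))
    (ht : ∀ k x, ∑ q ∈ Q, t k q x ^ 2 ≤ b k x ^ 2) (N : ℕ) {c : ℝ≥0} (hc : 0 < c)
    (htail : ∀ i < N, ∫⁻ x, ENNReal.ofReal (squareFn b (i + 1) x - squareFn b i x) *
        ∑ m ∈ Finset.range (N - i), ∑ q ∈ Q, ENNReal.ofReal (a (i + m) q x ^ 2) ∂ν
      ≤ (c : ℝ≥0∞) ^ 2 * ∫⁻ x, ENNReal.ofReal (squareFn b (i + 1) x - squareFn b i x) ∂ν) :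
    ∫⁻ x, ENNReal.ofReal (∑ k ∈ Finset.range N, ∑ q ∈ Q, a k q x * t k q x) ∂ν
      ≤ 2 * c * ∫⁻ x, ENNReal.ofReal (squareFn b N x) ∂ν := by
  have hc' : (0 : ℝ) < c := hc
  have hS : ∀ k, Measurable (squareFn b k) := fun k => measurable_squareFn fun j _ => hb j
  have hpt : ∀ x, ENNReal.ofReal (∑ k ∈ Finset.range N, ∑ q ∈ Q, a k q x * t k q x)
      ≤ c * ENNReal.ofReal (squareFn b N x) + ENNReal.ofReal (2 * c)⁻¹ *
        ∑ k ∈ Finset.range N, (∑ q ∈ Q, ENNReal.ofReal (a k q x ^ 2)) *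
          ENNReal.ofReal (squareFn b (k + 1) x) := by
    intro x
    have h1 : ∑ k ∈ Finset.range N, ∑ q ∈ Q, a k q x * t k q x
        ≤ c * squareFn b N x + (2 * c : ℝ)⁻¹ *
          ∑ k ∈ Finset.range N, (∑ q ∈ Q, a k q x ^ 2) * squareFn b (k + 1) x := by
      have h2 : squareFn b N x
          = ∑ k ∈ Finset.range N, (squareFn b (k + 1) x - squareFn b k x) := by
        rw [Finset.sum_range_sub fun i => squareFn b i x, squareFn_zero, sub_zero]
      rw [h2, Finset.mul_sum, Finset.mul_sum, ← Finset.sum_add_distrib]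
      refine Finset.sum_le_sum fun k _ => ?_
      refine (sum_mul_le_sub_add Q _ _ hc' (squareFn_nonneg b (k + 1) x) (squareFn_nonneg b k x)
        (squareFn_le_succ b k x) (squareFn_succ_sq b k x) (ht k x)).trans_eq ?_
      rw [div_eq_inv_mul]
    refine (ENNReal.ofReal_le_ofReal h1).trans_eq ?_
    have hnn : ∀ k, 0 ≤ (∑ q ∈ Q, a k q x ^ 2) * squareFn b (k + 1) x := fun k =>
      mul_nonneg (Finset.sum_nonneg fun q _ => sq_nonneg _) (squareFn_nonneg b _ x)
    rw [ENNReal.ofReal_add (mul_nonneg hc'.le (squareFn_nonneg b N x))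
      (mul_nonneg (by positivity) (Finset.sum_nonneg fun k _ => hnn k)),
      ENNReal.ofReal_mul hc'.le, ENNReal.ofReal_coe_nnreal, ENNReal.ofReal_mul (by positivity),
      ENNReal.ofReal_sum_of_nonneg fun k _ => hnn k]
    congr 2
    refine Finset.sum_congr rfl fun k _ => ?_
    rw [ENNReal.ofReal_mul (Finset.sum_nonneg fun q _ => sq_nonneg _),
      ENNReal.ofReal_sum_of_nonneg fun q _ => sq_nonneg _]
  have hcoef : ENNReal.ofReal (2 * c)⁻¹ * (c : ℝ≥0∞) ^ 2 ≤ c := by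
    rw [← ENNReal.ofReal_coe_nnreal, ← ENNReal.ofReal_pow hc'.le,
      ← ENNReal.ofReal_mul (by positivity)]
    refine ENNReal.ofReal_le_ofReal ?_
    have : (2 * (c : ℝ))⁻¹ * (c : ℝ) ^ 2 = c / 2 := by field_simp
    rw [this]
    linarith
  have hAm : ∀ k, Measurable fun x => ∑ q ∈ Q, ENNReal.ofReal (a k q x ^ 2) := fun k =>
    Finset.measurable_sum _ fun q _ => ((ha k q).pow_const 2).ennreal_ofReal
  calc _ ≤ ∫⁻ x, (c * ENNReal.ofReal (squareFn b N x) + ENNReal.ofReal (2 * c)⁻¹ *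
        ∑ k ∈ Finset.range N, (∑ q ∈ Q, ENNReal.ofReal (a k q x ^ 2)) *
          ENNReal.ofReal (squareFn b (k + 1) x)) ∂ν := lintegral_mono hpt
    _ = c * ∫⁻ x, ENNReal.ofReal (squareFn b N x) ∂ν + ENNReal.ofReal (2 * c)⁻¹ *
        ∫⁻ x, ∑ k ∈ Finset.range N, (∑ q ∈ Q, ENNReal.ofReal (a k q x ^ 2)) *
          ENNReal.ofReal (squareFn b (k + 1) x) ∂ν := by
        rw [lintegral_add_left ((hS N).ennreal_ofReal.const_mul _),
          lintegral_const_mul _ (hS N).ennreal_ofReal, lintegral_const_mul]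
        exact Finset.measurable_sum _ fun k _ => (hAm k).mul (hS _).ennreal_ofReal
    _ ≤ c * ∫⁻ x, ENNReal.ofReal (squareFn b N x) ∂ν + ENNReal.ofReal (2 * c)⁻¹ *
        (c ^ 2 * ∫⁻ x, ENNReal.ofReal (squareFn b N x) ∂ν) := by
        gcongr
        exact lintegral_sum_mul_squareFn_le ν hb hAm N _ htail
    _ ≤ c * ∫⁻ x, ENNReal.ofReal (squareFn b N x) ∂ν +
        c * ∫⁻ x, ENNReal.ofReal (squareFn b N x) ∂ν := by
        rw [← mul_assoc (ENNReal.ofReal _)]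
        gcongr
    _ = _ := by ring

end SquareFn

/-! ### Trigonometric polynomials with dominated coefficients -/

/-- The trigonometric polynomial `∑ coef γ · conj γ` over the tuples `γ` with entries in the
finite set `E` of characters. -/
noncomputable def trigPoly {G : Type*} [CommGroup G] [TopologicalSpace G]
    (E : Finset (PontryaginDual G)) {k : ℕ} (coef : (Fin k → PontryaginDual G) → ℂ)
    (x : ℕ → G) : ℂ :=
  ∑ γ ∈ Fintype.piFinset fun _ : Fin k => E, starRingEnd ℂ (charFun γ x) * coef γ

lemma sum_piFinset_add {Γ M : Type*} [AddCommMonoid M] (E : Finset Γ) (k m : ℕ)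
    (g : (Fin (k + m) → Γ) → M) :
    ∑ γ ∈ Fintype.piFinset (fun _ : Fin (k + m) => E), g γ
      = ∑ γ' ∈ Fintype.piFinset (fun _ : Fin m => E), ∑ γ ∈ Fintype.piFinset (fun _ : Fin k => E),
        g (Fin.append γ γ') := by
  rw [Finset.sum_comm, ← Finset.sum_product']
  refine (Finset.sum_equiv (Fin.appendEquiv k m) (fun p => ?_) fun p _ => rfl).symm
  simp only [Finset.mem_product, Fintype.mem_piFinset, Fin.appendEquiv, Equiv.coe_fn_mk,
    Fin.forall_fin_add, Fin.append_left, Fin.append_right]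

section TrigPoly

variable {G : Type*} [CommGroup G] [TopologicalSpace G] [MeasurableSpace G] [BorelSpace G]

lemma measurable_trigPoly (E : Finset (PontryaginDual G)) {k : ℕ}
    (coef : (Fin k → PontryaginDual G) → ℂ) : Measurable (trigPoly E coef) :=
  Finset.measurable_sum _ fun γ _ =>
    (Complex.continuous_conj.measurable.comp (measurable_charFun γ)).mul_const _

variable [IsTopologicalGroup G]

/-- Freezing the first `k` coordinates of a trigonometric polynomial leaves a trigonometric
polynomial in the remaining ones, whose coefficients are dominated by the sums over `Γ^k`. -/
lemma lintegral_enorm_sq_trigPoly_paste_le (μ : Measure G) [μ.IsHaarMeasure]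
    [IsProbabilityMeasure μ] (E : Finset (PontryaginDual G)) (k m : ℕ)
    {coef : (Fin (k + m) → PontryaginDual G) → ℂ} {l : (Fin (k + m) → PontryaginDual G) → ℝ≥0∞}
    (hl : ∀ γ, ‖coef γ‖ₑ ≤ l γ) (x : ℕ → G) :
    ∫⁻ y, ‖trigPoly E coef (paste k x y)‖ₑ ^ 2 ∂powMeasure μ
      ≤ ∑ γ' ∈ Fintype.piFinset (fun _ : Fin m => E),
        (∑ γ ∈ Fintype.piFinset (fun _ : Fin k => E), l (Fin.append γ γ')) ^ 2 := by
  have hexp : ∀ y, trigPoly E coef (paste k x y)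
      = ∑ γ' ∈ Fintype.piFinset (fun _ : Fin m => E), starRingEnd ℂ (charFun γ' y) •
        ∑ γ ∈ Fintype.piFinset (fun _ : Fin k => E),
          starRingEnd ℂ (charFun γ x) * coef (Fin.append γ γ') := by
    intro y
    rw [trigPoly, sum_piFinset_add]
    refine Finset.sum_congr rfl fun γ' _ => ?_
    rw [smul_eq_mul, Finset.mul_sum]
    refine Finset.sum_congr rfl fun γ _ => ?_
    rw [charFun_append_paste, map_mul]
    ring
  simp_rw [hexp]
  rw [lintegral_enorm_sq_sum_smul (powMeasure μ) _
    (χ := fun γ' y => starRingEnd ℂ (charFun γ' y))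
    (fun γ' => Complex.continuous_conj.measurable.comp (measurable_charFun γ'))
    (fun γ' y => by simp)]
  · refine Finset.sum_le_sum fun γ' _ => ?_
    gcongr
    refine (enorm_sum_le _ _).trans (Finset.sum_le_sum fun γ _ => ?_)
    have h1 : ‖starRingEnd ℂ (charFun γ x)‖ₑ = 1 := by
      rw [← ofReal_norm, RCLike.norm_conj, norm_charFun, ENNReal.ofReal_one]
    rw [enorm_mul, h1, one_mul]
    exact hl _
  · intro γ' _ γ'' _ hne
    refine Or.inr ?_
    rw [← integral_conj_charFun_mul_charFun μ hne.symm]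
    refine integral_congr_ae (.of_forall fun y => ?_)
    simp [mul_comm]

end TrigPoly

/-! ### The multiplier norm is dominated by the adapted norm -/

lemma sum_norm_sq_le_norm_sq {ι : Type*} {E : ι → Type*} [∀ i, NormedAddCommGroup (E i)]
    (f : lp E 2) (Q : Finset ι) : ∑ i ∈ Q, ‖f i‖ ^ 2 ≤ ‖f‖ ^ 2 := by
  have h := lp.sum_rpow_le_norm_rpow (p := 2) (by simp) f Q
  simpa using h

lemma exists_mul_eq_norm (z : ℂ) : ∃ u : ℂ, ‖u‖ ≤ 1 ∧ u * z = ‖z‖ := by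
  rcases eq_or_ne z 0 with rfl | hz
  · exact ⟨0, by simp⟩
  · have hz' : (‖z‖ : ℂ) ≠ 0 := by simpa using hz
    refine ⟨starRingEnd ℂ z / ‖z‖, by simp [hz], ?_⟩
    rw [div_mul_eq_mul_div, mul_comm, Complex.mul_conj, Complex.normSq_eq_norm_sq]
    field_simp
    push_cast
    ring

section Upper

variable {G : Type u} [CommGroup G] [TopologicalSpace G] {S : Type v}
  {lam : (k : ℕ) → (Fin k → PontryaginDual G) → S → ℝ≥0}

lemma sum_sq_le_of_adaptedNorm_le {c : ℝ≥0∞} (hc : adaptedNorm lam ≤ c) (k : ℕ) (M : Finset ℕ)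
    (S₀ : Finset S) (E : Finset (PontryaginDual G)) :
    ∑ m ∈ M, ∑ s ∈ S₀, ∑ γ' ∈ Fintype.piFinset (fun _ : Fin m => E),
      (∑ γ ∈ Fintype.piFinset (fun _ : Fin k => E), (lam (k + m) (Fin.append γ γ') s : ℝ≥0∞)) ^ 2
      ≤ c ^ 2 := by
  have h1 := (le_iSup (fun k : ℕ => (∑' m : ℕ, ∑' s : S, ∑' γ' : Fin m → PontryaginDual G,
    (∑' γ : Fin k → PontryaginDual G, (lam (k + m) (Fin.append γ γ') s : ℝ≥0∞)) ^ 2)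
      ^ (1 / 2 : ℝ)) k).trans hc
  rw [one_div, ENNReal.rpow_inv_le_iff two_pos, ENNReal.rpow_two] at h1
  refine le_trans ?_ h1
  refine (Finset.sum_le_sum fun m _ => (Finset.sum_le_sum fun s _ =>
    (Finset.sum_le_sum fun γ' _ => ?_).trans (ENNReal.sum_le_tsum _)).trans
      (ENNReal.sum_le_tsum _)).trans (ENNReal.sum_le_tsum _)
  gcongr
  exact ENNReal.sum_le_tsum _

/-- The sum of `lam |⟨f̂_k(γ), e_s⟩|` only has to be bounded over finite boxes. -/
lemma multiplierSum_le_of_forall_box [MeasurableSpace G] {μ : Measure G} [IsProbabilityMeasure μ]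
    {f : Lp (SeqHilbert S) 1 (powMeasure μ)} {B : ℝ≥0∞}
    (h : ∀ (N : ℕ) (E : Finset (PontryaginDual G)) (S₀ : Finset S),
      ∑ k ∈ Finset.range N, ∑ γ ∈ Fintype.piFinset (fun _ : Fin k => E), ∑ s ∈ S₀,
        (lam k γ s : ℝ≥0∞) * ‖(fourierCoeff f k γ : S → ℂ) s‖ₑ ≤ B) :
    multiplierSum lam f ≤ B := by
  classical
  rw [multiplierSum, ENNReal.tsum_eq_iSup_sum]
  refine iSup_le fun P => ?_
  set N := P.sup (fun p => p.1 + 1)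
  set E := P.biUnion fun p => Finset.univ.image p.2.1
  set S₀ := P.image fun p => p.2.2
  refine le_trans ?_ (h N E S₀)
  simp_rw [← Finset.sum_product']
  rw [Finset.sum_sigma' (Finset.range N) (fun k => (Fintype.piFinset fun _ : Fin k => E) ×ˢ S₀)
    fun k p => (lam k p.1 p.2 : ℝ≥0∞) * ‖(fourierCoeff f k p.1 : S → ℂ) p.2‖ₑ]
  refine Finset.sum_le_sum_of_subset fun p hp => ?_
  simp only [Finset.mem_sigma, Finset.mem_range, Finset.mem_product, Fintype.mem_piFinset]
  refine ⟨Nat.lt_of_succ_le (Finset.le_sup (f := fun p => p.1 + 1) hp), fun i => ?_, ?_⟩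
  · exact Finset.mem_biUnion.2 ⟨p, hp, Finset.mem_image_of_mem _ (Finset.mem_univ i)⟩
  · exact Finset.mem_image_of_mem (fun p => p.2.2) hp

variable [MeasurableSpace G] [BorelSpace G]

/-- The coordinate of a Fourier coefficient is the Fourier coefficient of the coordinate. -/
lemma fourierCoeff_apply {μ : Measure G} [IsProbabilityMeasure μ]
    (f : Lp (SeqHilbert S) 1 (powMeasure μ)) (k : ℕ) (γ : Fin k → PontryaginDual G) (s : S) :
    Integrable (fun x => starRingEnd ℂ (charFun γ x) * ((f x : ℕ → HilbertS S) k : S → ℂ) s)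
      (powMeasure μ) ∧
    (fourierCoeff f k γ : S → ℂ) s
      = ∫ x, starRingEnd ℂ (charFun γ x) * ((f x : ℕ → HilbertS S) k : S → ℂ) s
        ∂powMeasure μ := by
  have hf : Integrable f (powMeasure μ) := L1.integrable_coeFn f
  have hk : Integrable (fun x => (f x : ℕ → HilbertS S) k) (powMeasure μ) :=
    (lp.evalCLM ℂ (fun _ : ℕ => HilbertS S) 2 k).integrable_comp hf
  have hχ : Integrable (fun x => starRingEnd ℂ (charFun γ x) • (f x : ℕ → HilbertS S) k)
      (powMeasure μ) := by
    refine hk.bdd_smul (φ := fun x => starRingEnd ℂ (charFun γ x)) 1 ?_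
      (.of_forall fun x => by simp)
    exact (Complex.continuous_conj.measurable.comp (measurable_charFun γ)).aestronglyMeasurable
  refine ⟨(lp.evalCLM ℂ (fun _ : S => ℂ) 2 s).integrable_comp hχ, ?_⟩
  exact ((lp.evalCLM ℂ (fun _ : S => ℂ) 2 s).integral_comp_comm hχ).symm

variable [IsTopologicalGroup G]

/-- A box of the multiplier sum is an integral of products of `f` with trigonometric polynomials
whose coefficients have modulus at most `lam`. These polynomials satisfy the tail condition of the
Garsia–Herz inequality: given the first `i` coordinates, it is the Parseval identity. -/
lemma sum_box_le (μ : Measure G) [μ.IsHaarMeasure] [IsProbabilityMeasure μ]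
    {c : ℝ≥0} (hc0 : 0 < c) (hc : adaptedNorm lam ≤ c)
    {f : Lp (SeqHilbert S) 1 (powMeasure μ)} (hf : f ∈ adaptedL1 μ S)
    (N : ℕ) (E : Finset (PontryaginDual G)) (S₀ : Finset S) :
    ∑ k ∈ Finset.range N, ∑ γ ∈ Fintype.piFinset (fun _ : Fin k => E), ∑ s ∈ S₀,
        (lam k γ s : ℝ≥0∞) * ‖(fourierCoeff f k γ : S → ℂ) s‖ₑ ≤ 2 * c * ‖f‖ₑ := by
  choose ph hph1 hph2 using exists_mul_eq_norm
  set coef : (k : ℕ) → S → (Fin k → PontryaginDual G) → ℂ := fun k s γ =>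
    lam k γ s * ph ((fourierCoeff f k γ : S → ℂ) s) with hcoef
  have hcoef_le : ∀ k s γ, ‖coef k s γ‖ₑ ≤ lam k γ s := by
    intro k s γ
    rw [← ofReal_norm, ← ENNReal.ofReal_coe_nnreal]
    refine ENNReal.ofReal_le_ofReal ?_
    rw [hcoef, norm_mul]
    refine (mul_le_of_le_one_right (norm_nonneg _) (hph1 _)).trans_eq ?_
    simp
  set φ : ℕ → S → (ℕ → G) → ℂ := fun k s => trigPoly E (coef k s) with hφ
  have hφm : ∀ k s, Measurable (φ k s) := fun k s => measurable_trigPoly E _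
  -- adapted representatives of the components of `f`
  set g : ℕ → (ℕ → G) → HilbertS S := fun k => (hf k).mk _
  have hgm : ∀ k, StronglyMeasurable[coordFiltration G k] (g k) := fun k =>
    (hf k).stronglyMeasurable_mk
  have hfg : ∀ᵐ x ∂powMeasure μ, ∀ k, (f x : ℕ → HilbertS S) k = g k x :=
    ae_all_iff.2 fun k => (hf k).ae_eq_mk
  set b : ℕ → (ℕ → G) → ℝ := fun k x => ‖g k x‖ with hb
  have hbF : ∀ k, Measurable[coordFiltration G k] (b k) := fun k => (hgm k).norm.measurable
  have hbm : ∀ k, Measurable (b k) := fun k => (hbF k).mono ((coordFiltration G).le k) le_rfl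
  -- the box as the integral of a pointwise pairing
  have hsum : ∑ k ∈ Finset.range N, ∑ γ ∈ Fintype.piFinset (fun _ : Fin k => E), ∑ s ∈ S₀,
        (lam k γ s : ℝ≥0∞) * ‖(fourierCoeff f k γ : S → ℂ) s‖ₑ
      ≤ ∫⁻ x, ENNReal.ofReal (∑ k ∈ Finset.range N, ∑ s ∈ S₀,
          ‖φ k s x‖ * ‖(g k x : S → ℂ) s‖) ∂powMeasure μ := by
    have hterm : ∀ k γ s, (lam k γ s : ℝ≥0∞) * ‖(fourierCoeff f k γ : S → ℂ) s‖ₑ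
        = ENNReal.ofReal (lam k γ s * ‖(fourierCoeff f k γ : S → ℂ) s‖) := fun k γ s => by
      rw [ENNReal.ofReal_mul (NNReal.coe_nonneg _), ENNReal.ofReal_coe_nnreal, ofReal_norm]
    have hnn : ∀ k γ s, 0 ≤ (lam k γ s : ℝ) * ‖(fourierCoeff f k γ : S → ℂ) s‖ :=
      fun k γ s => by positivity
    simp_rw [hterm]
    have e1 : ∑ k ∈ Finset.range N, ∑ γ ∈ Fintype.piFinset (fun _ : Fin k => E), ∑ s ∈ S₀,
        ENNReal.ofReal (lam k γ s * ‖(fourierCoeff f k γ : S → ℂ) s‖)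
        = ENNReal.ofReal (∑ k ∈ Finset.range N, ∑ γ ∈ Fintype.piFinset (fun _ : Fin k => E),
          ∑ s ∈ S₀, lam k γ s * ‖(fourierCoeff f k γ : S → ℂ) s‖) := by
      rw [ENNReal.ofReal_sum_of_nonneg fun k _ => Finset.sum_nonneg fun γ _ =>
        Finset.sum_nonneg fun s _ => hnn k γ s]
      refine Finset.sum_congr rfl fun k _ => ?_
      rw [ENNReal.ofReal_sum_of_nonneg fun γ _ => Finset.sum_nonneg fun s _ => hnn k γ s]
      refine Finset.sum_congr rfl fun γ _ => ?_
      rw [ENNReal.ofReal_sum_of_nonneg fun s _ => hnn k γ s]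
    have hint : ∀ k γ s, Integrable (fun x => coef k s γ *
        (starRingEnd ℂ (charFun γ x) * ((f x : ℕ → HilbertS S) k : S → ℂ) s)) (powMeasure μ) :=
      fun k γ s => (fourierCoeff_apply f k γ s).1.const_mul _
    have e2 : ((∑ k ∈ Finset.range N, ∑ γ ∈ Fintype.piFinset (fun _ : Fin k => E),
          ∑ s ∈ S₀, lam k γ s * ‖(fourierCoeff f k γ : S → ℂ) s‖ : ℝ) : ℂ)
        = ∫ x, ∑ k ∈ Finset.range N, ∑ s ∈ S₀,
          φ k s x * ((f x : ℕ → HilbertS S) k : S → ℂ) s ∂powMeasure μ := by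
      have e3 : ∀ x, ∑ k ∈ Finset.range N, ∑ s ∈ S₀,
          φ k s x * ((f x : ℕ → HilbertS S) k : S → ℂ) s
          = ∑ k ∈ Finset.range N, ∑ γ ∈ Fintype.piFinset (fun _ : Fin k => E), ∑ s ∈ S₀,
            coef k s γ *
              (starRingEnd ℂ (charFun γ x) * ((f x : ℕ → HilbertS S) k : S → ℂ) s) := by
        intro x
        refine Finset.sum_congr rfl fun k _ => ?_
        rw [Finset.sum_comm]
        refine Finset.sum_congr rfl fun s _ => ?_
        rw [hφ]
        simp only [trigPoly]
        rw [Finset.sum_mul]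
        exact Finset.sum_congr rfl fun γ _ => by ring
      simp_rw [e3]
      rw [integral_finsetSum _ fun k _ => integrable_finsetSum _ fun γ _ =>
        integrable_finsetSum _ fun s _ => hint k γ s, Complex.ofReal_sum]
      refine Finset.sum_congr rfl fun k _ => ?_
      rw [integral_finsetSum _ fun γ _ => integrable_finsetSum _ fun s _ => hint k γ s,
        Complex.ofReal_sum]
      refine Finset.sum_congr rfl fun γ _ => ?_
      rw [integral_finsetSum _ fun s _ => hint k γ s, Complex.ofReal_sum]
      refine Finset.sum_congr rfl fun s _ => ?_
      rw [integral_const_mul, ← (fourierCoeff_apply f k γ s).2, hcoef]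
      simp only
      rw [mul_assoc, hph2, Complex.ofReal_mul]
    have e4 : ENNReal.ofReal (∑ k ∈ Finset.range N,
          ∑ γ ∈ Fintype.piFinset (fun _ : Fin k => E),
          ∑ s ∈ S₀, lam k γ s * ‖(fourierCoeff f k γ : S → ℂ) s‖)
        = ‖((∑ k ∈ Finset.range N, ∑ γ ∈ Fintype.piFinset (fun _ : Fin k => E),
          ∑ s ∈ S₀, lam k γ s * ‖(fourierCoeff f k γ : S → ℂ) s‖ : ℝ) : ℂ)‖ₑ := by
      rw [← ofReal_norm, Complex.norm_real, Real.norm_of_nonneg]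
      exact Finset.sum_nonneg fun k _ => Finset.sum_nonneg fun γ _ =>
        Finset.sum_nonneg fun s _ => hnn k γ s
    rw [e1, e4, e2]
    refine (enorm_integral_le_lintegral_enorm _).trans (lintegral_mono_ae ?_)
    filter_upwards [hfg] with x hx
    rw [← ofReal_norm]
    refine ENNReal.ofReal_le_ofReal ?_
    refine (norm_sum_le _ _).trans (Finset.sum_le_sum fun k _ => ?_)
    refine (norm_sum_le _ _).trans (Finset.sum_le_sum fun s _ => ?_)
    rw [norm_mul, hx k]
  -- the square function of `f` is at most its norm
  have hS : ∫⁻ x, ENNReal.ofReal (squareFn b N x) ∂powMeasure μ ≤ ‖f‖ₑ := by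
    rw [Lp.enorm_def, eLpNorm_one_eq_lintegral_enorm]
    refine lintegral_mono_ae ?_
    filter_upwards [hfg] with x hx
    rw [← ofReal_norm]
    refine ENNReal.ofReal_le_ofReal (Real.sqrt_le_iff.2 ⟨norm_nonneg _, ?_⟩)
    simp only [hb, ← hx]
    exact sum_norm_sq_le_norm_sq (f x) (Finset.range N)
  refine hsum.trans (le_trans ?_ (mul_le_mul_right hS _))
  refine lintegral_sum_sum_mul_le (powMeasure μ) S₀ hbm (fun k s => (hφm k s).norm)
    (fun k x => sum_norm_sq_le_norm_sq (g k x) S₀) N hc0 fun i hi => ?_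
  -- the increment of the square function depends on the first `i` coordinates only
  set D : (ℕ → G) → ℝ≥0∞ := fun x =>
    ENNReal.ofReal (squareFn b (i + 1) x - squareFn b i x)
  have hDF : Measurable[coordFiltration G i] D := by
    have hbi : ∀ j ≤ i, Measurable[coordFiltration G i] (b j) := fun j hj =>
      (hbF j).mono ((coordFiltration G).mono hj) le_rfl
    exact ((measurable_squareFn fun j hj => hbi j (by omega)).sub
      (measurable_squareFn fun j hj => hbi j (by omega))).ennreal_ofReal
  have hDm : Measurable D := hDF.mono ((coordFiltration G).le i) le_rfl
  have hsq : ∀ m s x, ENNReal.ofReal (‖φ (i + m) s x‖ ^ 2) = ‖φ (i + m) s x‖ₑ ^ 2 :=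
    fun m s x => by rw [ENNReal.ofReal_pow (norm_nonneg _), ofReal_norm]
  have hφe : ∀ m s, Measurable fun x => ‖φ (i + m) s x‖ₑ ^ 2 :=
    fun m s => (hφm _ s).enorm.pow_const 2
  simp_rw [hsq]
  change ∫⁻ x, D x * _ ∂powMeasure μ ≤ _
  rw [lintegral_eq_lintegral_lintegral_paste μ i
    (F := fun x => D x * ∑ m ∈ Finset.range (N - i), ∑ s ∈ S₀, ‖φ (i + m) s x‖ₑ ^ 2)
    (hDm.mul (Finset.measurable_fun_sum _ fun m _ =>
      Finset.measurable_fun_sum _ fun s _ => hφe m s)), ← lintegral_const_mul _ hDm]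
  refine lintegral_mono fun x => ?_
  have hφp : ∀ m s, Measurable fun y => ‖φ (i + m) s (paste i x y)‖ₑ ^ 2 := fun m s =>
    (hφe m s).comp ((measurable_paste i).comp measurable_prodMk_left)
  simp only [apply_paste_of_measurable hDF]
  rw [lintegral_const_mul _ (Finset.measurable_fun_sum _ fun m _ =>
    Finset.measurable_fun_sum _ fun s _ => hφp m s), mul_comm]
  gcongr
  rw [lintegral_finsetSum _ fun m _ => Finset.measurable_fun_sum _ fun s _ => hφp m s]
  refine le_trans (Finset.sum_le_sum fun m _ => ?_)
    (sum_sq_le_of_adaptedNorm_le hc i (Finset.range (N - i)) S₀ E)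
  rw [lintegral_finsetSum _ fun s _ => hφp m s]
  exact Finset.sum_le_sum fun s _ =>
    lintegral_enorm_sq_trigPoly_paste_le μ E i m (fun γ => hcoef_le (i + m) s γ) x

theorem multiplierNorm_le (μ : Measure G) [μ.IsHaarMeasure] [IsProbabilityMeasure μ]
    (lam : (k : ℕ) → (Fin k → PontryaginDual G) → S → ℝ≥0) :
    multiplierNorm μ lam ≤ 2 * adaptedNorm lam := by
  refine ENNReal.le_of_forall_pos_le_add fun ε hε hfin => ?_
  have hne : adaptedNorm lam ≠ ∞ := fun h => by simp [h] at hfin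
  obtain ⟨r, hr⟩ := WithTop.ne_top_iff_exists.1 hne
  replace hr : (r : ℝ≥0∞) = adaptedNorm lam := hr
  -- enlarging the bound by `ε / 2` makes it positive, as the weight in the inequality requires
  set c : ℝ≥0 := r + ε / 2 with hc
  have hle : multiplierNorm μ lam ≤ 2 * c := by
    refine sInf_le fun f hf => multiplierSum_le_of_forall_box fun N E S₀ =>
      sum_box_le μ (by positivity) ?_ hf N E S₀
    rw [← hr]
    exact ENNReal.coe_le_coe.2 le_self_add
  refine hle.trans_eq ?_
  rw [← hr]
  have : (2 * c : ℝ≥0) = 2 * r + ε := by rw [hc]; ring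
  exact_mod_cast this

end Upper

/-! ### The adapted norm is dominated by the multiplier norm -/

section Lower

variable {G : Type u} [CommGroup G] [TopologicalSpace G] [MeasurableSpace G] [BorelSpace G]

/-- An approximate unit for finitely many characters of `G^k`: the normalized indicator of a
neighbourhood of the identity on which their real parts exceed `1 / 2`. -/
lemma exists_approximate_unit (μ : Measure G) [μ.IsHaarMeasure] [IsProbabilityMeasure μ] (k : ℕ)
    (F : Finset (Fin k → PontryaginDual G)) :
    ∃ D : (ℕ → G) → ℝ, Measurable[coordFiltration G k] D ∧ (∃ K, ∀ x, ‖D x‖ ≤ K) ∧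
      ∫⁻ x, ‖D x‖ₑ ∂powMeasure μ = 1 ∧
      ∀ γ ∈ F, (1 / 2 : ℝ) ≤ ‖∫ x, starRingEnd ℂ (charFun γ x) * D x ∂powMeasure μ‖ := by
  set U : Set (ℕ → G) := ⋂ γ ∈ F, {x | 1 / 2 < (charFun γ x).re} with hU
  have hUm : MeasurableSet[coordFiltration G k] U :=
    Finset.measurableSet_biInter _ fun γ _ => by
      have h : Measurable[coordFiltration G k] fun x => (charFun γ x).re :=
        Complex.measurable_re.comp (measurable_coordFiltration_charFun γ)
      exact h measurableSet_Ioi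
  have hUm' : MeasurableSet U := (coordFiltration G).le k _ hUm
  have hUo : IsOpen U := isOpen_biInter_finset fun γ _ => by
    refine isOpen_lt continuous_const (Complex.continuous_re.comp ?_)
    exact continuous_finsetProd _ fun i _ => continuous_subtype_val.comp
      ((map_continuous (γ i)).comp (continuous_apply (i : ℕ)))
  have hU1 : (1 : ℕ → G) ∈ U := by
    simp only [hU, Set.mem_iInter, Set.mem_ofPred_eq]
    intro γ _
    have : charFun γ (1 : ℕ → G) = 1 := Finset.prod_eq_one fun i _ => by simp
    rw [this]
    norm_num
  have hpos : powMeasure μ U ≠ 0 := by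
    obtain ⟨I, V, hV, hVU⟩ := isOpen_pi_iff.1 hUo 1 hU1
    refine (lt_of_lt_of_le ?_ (measure_mono hVU)).ne'
    rw [Measure.infinitePi_pi _ fun i hi => (hV i hi).1.measurableSet]
    exact pos_iff_ne_zero.2 (Finset.prod_ne_zero_iff.2 fun i hi =>
      ((hV i hi).1.measure_pos μ ⟨_, (hV i hi).2⟩).ne')
  set p : ℝ := (powMeasure μ).real U with hp
  have hp0 : 0 < p := ENNReal.toReal_pos hpos (measure_ne_top _ _)
  have hDm : Measurable[coordFiltration G k] (U.indicator fun _ => p⁻¹) :=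
    Measurable.indicator measurable_const hUm
  refine ⟨U.indicator fun _ => p⁻¹, hDm, ⟨p⁻¹, fun x => ?_⟩, ?_, fun γ hγ => ?_⟩
  · refine (norm_indicator_le_norm_self _ _).trans_eq ?_
    exact Real.norm_of_nonneg (by positivity)
  · simp_rw [enorm_indicator_eq_indicator_enorm]
    rw [lintegral_indicator_const hUm', Real.enorm_of_nonneg (by positivity), hp,
      ENNReal.ofReal_inv_of_pos hp0, ofReal_measureReal]
    exact ENNReal.inv_mul_cancel hpos (measure_ne_top _ _)
  · have h1 : ∫ x, starRingEnd ℂ (charFun γ x) * (U.indicator (fun _ => p⁻¹) x : ℝ) ∂powMeasure μ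
        = ∫ x in U, starRingEnd ℂ (charFun γ x) * (p⁻¹ : ℝ) ∂powMeasure μ := by
      rw [← integral_indicator hUm']
      refine integral_congr_ae (.of_forall fun x => ?_)
      by_cases hx : x ∈ U <;> simp [hx]
    have hint : Integrable (fun x => starRingEnd ℂ (charFun γ x) * (p⁻¹ : ℝ))
        ((powMeasure μ).restrict U) := by
      refine Integrable.of_bound (C := ‖p⁻¹‖) ?_ (.of_forall fun x => by simp)
      exact ((Complex.continuous_conj.measurable.comp (measurable_charFun γ)).mul_const
        _).aestronglyMeasurable
    rw [h1]
    refine le_trans ?_ (Complex.re_le_norm _)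
    have h2 := integral_re hint
    simp only [RCLike.re_to_complex] at h2
    rw [← h2]
    calc (1 / 2 : ℝ) = ∫ x in U, (1 / 2) * p⁻¹ ∂powMeasure μ := by
          rw [setIntegral_const, smul_eq_mul, ← hp]
          field_simp
      _ ≤ _ := by
          refine setIntegral_mono_on (integrable_const _) hint.re hUm' fun x hx => ?_
          have hx' : 1 / 2 < (charFun γ x).re := Set.mem_iInter₂.1 hx γ hγ
          rw [Complex.re_mul_ofReal, Complex.conj_re]
          gcongr

variable [IsTopologicalGroup G] {S : Type v}

open Classical in
/-- The basis vector of `ℓ²(ℕ, ℓ²(S))` at the component `j` and the coordinate `s`. -/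
noncomputable def basisVec (j : ℕ) (s : S) : SeqHilbert S :=
  lp.single 2 j (lp.single 2 s (1 : ℂ))

lemma basisVec_apply_of_ne {j i : ℕ} (s : S) (h : i ≠ j) :
    (basisVec j s : ℕ → HilbertS S) i = 0 := by
  classical
  exact lp.single_apply_ne 2 j _ h

lemma basisVec_apply_apply_self (j : ℕ) (s : S) :
    ((basisVec j s : ℕ → HilbertS S) j : S → ℂ) s = 1 := by
  simp [basisVec]

lemma basisVec_apply_apply_of_ne {j i : ℕ} {s r : S} (h : i ≠ j ∨ r ≠ s) :
    ((basisVec j s : ℕ → HilbertS S) i : S → ℂ) r = 0 := by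
  by_cases hij : i = j
  · subst hij
    simp [basisVec, h.resolve_left (not_not.2 rfl)]
  · rw [basisVec_apply_of_ne s hij]
    rfl

lemma norm_basisVec (j : ℕ) (s : S) : ‖basisVec j s‖ = 1 := by
  simp [basisVec, lp.norm_single]

lemma inner_basisVec_left (j : ℕ) (s : S) (f : SeqHilbert S) :
    inner ℂ (basisVec j s) f = ((f : ℕ → HilbertS S) j : S → ℂ) s := by
  classical
  rw [basisVec, lp.inner_single_left, lp.inner_single_left]
  simp

variable (μ : Measure G) [μ.IsHaarMeasure] [IsProbabilityMeasure μ]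

/-- The functions `γ' ⊗ e_{j,s}` are pairwise orthogonal, because their vectors or their characters
are. -/
lemma basisVec_apply_eq_zero_or_integral_eq_zero (k : ℕ)
    {q q' : Σ m : ℕ, S × (Fin m → PontryaginDual G)} (h : q ≠ q') :
    ((basisVec (k + q'.1) q'.2.1 : ℕ → HilbertS S) (k + q.1) : S → ℂ) q.2.1 = 0 ∨
      ∫ y, starRingEnd ℂ (charFun q.2.2 y) * charFun q'.2.2 y ∂powMeasure μ = 0 := by
  obtain ⟨m, s, γ⟩ := q
  obtain ⟨m', s', γ'⟩ := q'
  by_cases hm : m = m'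
  · subst hm
    by_cases hs : s = s'
    · subst hs
      refine Or.inr (integral_conj_charFun_mul_charFun μ ?_)
      rintro rfl
      exact h rfl
    · exact Or.inl (basisVec_apply_apply_of_ne (Or.inr hs))
  · exact Or.inl (basisVec_apply_apply_of_ne (Or.inl fun h => hm (by simpa using h)))

/-- The trigonometric polynomial `∑ l_q γ'_q ⊗ e_q` has `L¹` norm at most the `ℓ²` norm of its
coefficients. -/
lemma lintegral_enorm_sum_smul_basisVec_le (k : ℕ)
    (P : Finset (Σ m : ℕ, S × (Fin m → PontryaginDual G)))
    (l : (Σ m : ℕ, S × (Fin m → PontryaginDual G)) → ℝ≥0) :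
    ∫⁻ y, ‖∑ q ∈ P, charFun q.2.2 y • ((l q : ℂ) • basisVec (k + q.1) q.2.1)‖ₑ ∂powMeasure μ
      ≤ (∑ q ∈ P, (l q : ℝ≥0∞) ^ 2) ^ (1 / 2 : ℝ) := by
  have hpars := lintegral_enorm_sq_sum_smul (powMeasure μ) P
    (χ := fun q : (Σ m : ℕ, S × (Fin m → PontryaginDual G)) => charFun q.2.2)
    (fun q => measurable_charFun _) (fun q y => norm_charFun _ y)
    (fun q => (l q : ℂ) • basisVec (k + q.1) q.2.1) fun q _ q' _ hne => by
      rw [inner_smul_left, inner_smul_right, inner_basisVec_left]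
      rcases basisVec_apply_eq_zero_or_integral_eq_zero μ k hne with h | h
      · exact Or.inl (by rw [h]; simp)
      · exact Or.inr h
  have hnorm : ∀ q : (Σ m : ℕ, S × (Fin m → PontryaginDual G)),
      ‖(l q : ℂ) • basisVec (k + q.1) q.2.1‖ₑ = l q := fun q => by
    rw [← ofReal_norm, norm_smul, norm_basisVec, mul_one]
    simp
  simp_rw [hnorm] at hpars
  have hsm : StronglyMeasurable fun y : ℕ → G =>
      ∑ q ∈ P, charFun q.2.2 y • ((l q : ℂ) • basisVec (k + q.1) q.2.1) :=
    Finset.stronglyMeasurable_fun_sum _ fun q _ =>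
      (measurable_charFun q.2.2).stronglyMeasurable.smul_const _
  have h := eLpNorm_le_eLpNorm_of_exponent_le (μ := powMeasure μ) (p := 1) (q := 2)
    (by norm_num) hsm.aestronglyMeasurable
  rw [eLpNorm_one_eq_lintegral_enorm, eLpNorm_eq_lintegral_rpow_enorm_toReal (by simp) (by simp)]
    at h
  rw [← hpars]
  simpa using h

/-- Testing the multiplier inequality on `D(x₁, …, x_k) ∑_q l_q γ'_q(x_{k+1}, …) e_q`, where `D` is
an approximate unit for the characters in `F` and `l_q` is the sum of `lam` over `F ⊗ γ'_q`. -/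
lemma sum_sq_le_of_multiplierSum_le {lam : (k : ℕ) → (Fin k → PontryaginDual G) → S → ℝ≥0}
    {A : ℝ≥0∞} (hA : ∀ f ∈ adaptedL1 μ S, multiplierSum lam f ≤ A * ‖f‖ₑ) (k : ℕ)
    (P : Finset (Σ m : ℕ, S × (Fin m → PontryaginDual G)))
    (F : Finset (Fin k → PontryaginDual G)) :
    ∑ q ∈ P, (∑ γ ∈ F, (lam (k + q.1) (Fin.append γ q.2.2) q.2.1 : ℝ≥0∞)) ^ 2 ≤ (2 * A) ^ 2 := by
  obtain ⟨D, hDF, ⟨K, hK⟩, hD1, hDhat⟩ := exists_approximate_unit μ k F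
  have hDm : Measurable D := hDF.mono ((coordFiltration G).le k) le_rfl
  set l : (Σ m : ℕ, S × (Fin m → PontryaginDual G)) → ℝ≥0 := fun q =>
    ∑ γ ∈ F, lam (k + q.1) (Fin.append γ q.2.2) q.2.1 with hl
  have hl' : ∀ q : (Σ m : ℕ, S × (Fin m → PontryaginDual G)),
      ∑ γ ∈ F, (lam (k + q.1) (Fin.append γ q.2.2) q.2.1 : ℝ≥0∞) = l q := fun q => by
    rw [hl]; push_cast; rfl
  simp_rw [hl']
  set R : ℝ≥0∞ := ∑ q ∈ P, (l q : ℝ≥0∞) ^ 2 with hR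
  -- the scalar factors of the test function
  set w : (Σ m : ℕ, S × (Fin m → PontryaginDual G)) → (ℕ → G) → ℂ := fun q z =>
    (D z : ℂ) * l q * charFun (Fin.append (1 : Fin k → PontryaginDual G) q.2.2) z with hw
  have hwF : ∀ q, Measurable[coordFiltration G (k + q.1)] (w q) := fun q => by
    have h1 : Measurable[coordFiltration G (k + q.1)] fun z => (D z : ℂ) :=
      Complex.measurable_ofReal.comp
        (hDF.mono ((coordFiltration G).mono (Nat.le_add_right k q.1)) le_rfl)
    exact (h1.mul_const _).mul (measurable_coordFiltration_charFun _)
  have hwm : ∀ q, Measurable (w q) := fun q =>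
    (hwF q).mono ((coordFiltration G).le _) le_rfl
  have hwb : ∀ q z, ‖w q z‖ ≤ K * l q := fun q z => by
    have : ‖w q z‖ = ‖D z‖ * l q := by simp [hw]
    rw [this]
    gcongr
    exact hK z
  have hwp : ∀ q x y, w q (paste k x y) = D x * (l q * charFun q.2.2 y) := fun q x y => by
    have h1 : charFun (1 : Fin k → PontryaginDual G) x = 1 :=
      Finset.prod_eq_one fun i _ => by simp
    simp only [hw]
    rw [charFun_append_paste, apply_paste_of_measurable hDF, h1, one_mul, mul_assoc]
  set h : (ℕ → G) → SeqHilbert S := fun z => ∑ q ∈ P, w q z • basisVec (k + q.1) q.2.1 with hh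
  have hhm : StronglyMeasurable h := Finset.stronglyMeasurable_fun_sum _ fun q _ =>
    (hwm q).stronglyMeasurable.smul_const _
  have hhL : MemLp h 1 (powMeasure μ) := by
    refine MemLp.of_bound hhm.aestronglyMeasurable (∑ q ∈ P, K * l q) (.of_forall fun z => ?_)
    refine (norm_sum_le _ _).trans (Finset.sum_le_sum fun q _ => ?_)
    rw [norm_smul, norm_basisVec, mul_one]
    exact hwb q z
  set f : Lp (SeqHilbert S) 1 (powMeasure μ) := hhL.toLp h
  have hfh : f =ᵐ[powMeasure μ] h := hhL.coeFn_toLp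
  have happ : ∀ z j, (h z : ℕ → HilbertS S) j
      = ∑ q ∈ P, w q z • (basisVec (k + q.1) q.2.1 : ℕ → HilbertS S) j := fun z j => by
    simp only [hh, lp.coeFn_sum, Finset.sum_apply, lp.coeFn_smul, Pi.smul_apply]
  have hfX : f ∈ adaptedL1 μ S := by
    intro j
    refine ⟨fun z => ∑ q ∈ P, w q z • (basisVec (k + q.1) q.2.1 : ℕ → HilbertS S) j, ?_, ?_⟩
    · refine Finset.stronglyMeasurable_fun_sum _ fun q _ => ?_
      by_cases hj : j = k + q.1
      · subst hj
        exact (hwF q).stronglyMeasurable.smul_const _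
      · simp only [basisVec_apply_of_ne _ hj, smul_zero]
        exact stronglyMeasurable_const
    · filter_upwards [hfh] with z hz
      rw [hz, happ]
  -- the norm of the test function
  have hfnorm : ‖f‖ₑ ≤ R ^ (1 / 2 : ℝ) := by
    rw [Lp.enorm_def, eLpNorm_one_eq_lintegral_enorm,
      lintegral_congr_ae (hfh.mono fun z hz => by rw [hz] : _ =ᵐ[_] fun z => ‖h z‖ₑ),
      lintegral_eq_lintegral_lintegral_paste μ k hhm.enorm]
    have e1 : ∀ x y, ‖h (paste k x y)‖ₑ = ‖D x‖ₑ *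
        ‖∑ q ∈ P, charFun q.2.2 y • ((l q : ℂ) • basisVec (k + q.1) q.2.1)‖ₑ := fun x y => by
      have : h (paste k x y) = (D x : ℂ) •
          ∑ q ∈ P, charFun q.2.2 y • ((l q : ℂ) • basisVec (k + q.1) q.2.1) := by
        simp only [hh, hwp, Finset.smul_sum, smul_smul]
        refine Finset.sum_congr rfl fun q _ => ?_
        rw [mul_comm (l q : ℂ)]
      rw [this, enorm_smul]
      congr 1
      rw [← ofReal_norm, ← ofReal_norm, Complex.norm_real]
    have hgm : Measurable fun y : ℕ → G =>
        ‖∑ q ∈ P, charFun q.2.2 y • ((l q : ℂ) • basisVec (k + q.1) q.2.1)‖ₑ :=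
      StronglyMeasurable.enorm (Finset.stronglyMeasurable_fun_sum _ fun q _ =>
        (measurable_charFun q.2.2).stronglyMeasurable.smul_const _)
    simp_rw [e1]
    simp_rw [lintegral_const_mul _ hgm]
    rw [lintegral_mul_const _ hDm.enorm, hD1, one_mul]
    exact lintegral_enorm_sum_smul_basisVec_le μ k P l
  -- the Fourier coefficients of the test function
  have hcoeff : ∀ q ∈ P, ∀ γ : Fin k → PontryaginDual G,
      (fourierCoeff f (k + q.1) (Fin.append γ q.2.2) : S → ℂ) q.2.1
        = (∫ x, starRingEnd ℂ (charFun γ x) * D x ∂powMeasure μ) * l q := by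
    intro q hq γ
    obtain ⟨hint, heq⟩ := fourierCoeff_apply f (k + q.1) (Fin.append γ q.2.2) q.2.1
    set v : (Σ m : ℕ, S × (Fin m → PontryaginDual G)) → ℂ := fun q' =>
      ((basisVec (k + q'.1) q'.2.1 : ℕ → HilbertS S) (k + q.1) : S → ℂ) q.2.1 with hv
    have hae : (fun z => starRingEnd ℂ (charFun (Fin.append γ q.2.2) z) *
        ((f z : ℕ → HilbertS S) (k + q.1) : S → ℂ) q.2.1) =ᵐ[powMeasure μ]
        fun z => starRingEnd ℂ (charFun (Fin.append γ q.2.2) z) * ∑ q' ∈ P, w q' z * v q' := by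
      filter_upwards [hfh] with z hz
      rw [hz, happ]
      simp only [lp.coeFn_sum, Finset.sum_apply, lp.coeFn_smul, Pi.smul_apply, smul_eq_mul, hv]
    rw [heq, integral_congr_ae hae,
      integral_eq_integral_integral_paste μ k (hint.congr hae), ← integral_mul_const]
    refine integral_congr_ae (.of_forall fun x => ?_)
    simp only [hwp, charFun_append_paste, map_mul]
    have e2 : ∀ y, starRingEnd ℂ (charFun γ x) * starRingEnd ℂ (charFun q.2.2 y) *
        ∑ q' ∈ P, (D x : ℂ) * (l q' * charFun q'.2.2 y) * v q'
        = ∑ q' ∈ P, starRingEnd ℂ (charFun γ x) * D x * (l q' * v q') *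
          (starRingEnd ℂ (charFun q.2.2 y) * charFun q'.2.2 y) := fun y => by
      rw [Finset.mul_sum]
      exact Finset.sum_congr rfl fun q' _ => by ring
    have hmm : ∀ q' : (Σ m : ℕ, S × (Fin m → PontryaginDual G)),
        Integrable (fun y => starRingEnd ℂ (charFun q.2.2 y) * charFun q'.2.2 y)
          (powMeasure μ) := fun q' =>
      Integrable.of_bound (((Complex.continuous_conj.measurable.comp
        (measurable_charFun q.2.2)).mul (measurable_charFun q'.2.2)).aestronglyMeasurable) 1
        (.of_forall fun y => by simp)
    simp_rw [e2]
    rw [integral_finsetSum _ fun q' _ => (hmm q').const_mul _, Finset.sum_eq_single_of_mem q hq]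
    · have e3 : ∀ y, starRingEnd ℂ (charFun q.2.2 y) * charFun q.2.2 y = 1 := fun y => by
        rw [mul_comm, Complex.mul_conj, Complex.normSq_eq_norm_sq, norm_charFun]; simp
      have e4 : v q = 1 := basisVec_apply_apply_self _ _
      simp only [e3, e4, mul_one, integral_const, probReal_univ, one_smul]
    · intro q' _ hne
      rw [integral_const_mul]
      rcases basisVec_apply_eq_zero_or_integral_eq_zero μ k hne.symm with h0 | h0
      · have : v q' = 0 := h0
        rw [this]
        simp
      · rw [h0, mul_zero]
  -- the multiplier sum of the test function
  have hlow : R / 2 ≤ multiplierSum lam f := by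
    have hinj : Function.Injective
        fun p : (Σ m : ℕ, S × (Fin m → PontryaginDual G)) × (Fin k → PontryaginDual G) =>
          (⟨k + p.1.1, (Fin.append p.2 p.1.2.2, p.1.2.1)⟩ :
            Σ j : ℕ, (Fin j → PontryaginDual G) × S) := by
      rintro ⟨⟨m, s, γ'⟩, γ⟩ ⟨⟨m', s', δ'⟩, δ⟩ hpq
      simp only [Sigma.mk.injEq] at hpq
      obtain ⟨h1, h2⟩ := hpq
      obtain rfl : m = m' := by omega
      simp only [heq_eq_eq, Prod.mk.injEq] at h2
      obtain ⟨h3, rfl⟩ := h2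
      have h4 : (γ, γ') = (δ, δ') := (Fin.appendEquiv k m).injective h3
      simp only [Prod.mk.injEq] at h4
      obtain ⟨rfl, rfl⟩ := h4
      rfl
    refine le_trans ?_ (ENNReal.tsum_comp_le_tsum_of_injective hinj _)
    refine le_trans ?_ (ENNReal.sum_le_tsum (P ×ˢ F))
    rw [Finset.sum_product, hR, ENNReal.div_eq_inv_mul, Finset.mul_sum]
    refine Finset.sum_le_sum fun q hq => ?_
    have e5 : (2⁻¹ : ℝ≥0∞) * (l q : ℝ≥0∞) ^ 2 = ∑ γ ∈ F,
        (lam (k + q.1) (Fin.append γ q.2.2) q.2.1 : ℝ≥0∞) * (2⁻¹ * l q) := by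
      rw [← Finset.sum_mul, hl']
      ring
    rw [e5]
    refine Finset.sum_le_sum fun γ hγ => ?_
    simp only
    rw [hcoeff q hq γ, enorm_mul]
    gcongr
    · rw [← ofReal_norm]
      refine le_trans (le_of_eq ?_) (ENNReal.ofReal_le_ofReal (hDhat γ hγ))
      rw [one_div, ENNReal.ofReal_inv_of_pos two_pos]
      simp
    · rw [← ofReal_norm]
      simp
  have hmain : R / 2 ≤ A * R ^ (1 / 2 : ℝ) :=
    hlow.trans ((hA f hfX).trans (by gcongr))
  have hRtop : R ≠ ∞ := ENNReal.sum_ne_top.2 fun q _ => ENNReal.pow_ne_top ENNReal.coe_ne_top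
  rcases eq_or_ne R 0 with h0 | h0
  · rw [h0]; exact zero_le
  set r := R ^ (1 / 2 : ℝ) with hr
  have hrr : r ^ 2 = R := by
    rw [hr, ← ENNReal.rpow_natCast, ← ENNReal.rpow_mul]
    norm_num
  have hr0 : r ≠ 0 := fun h => h0 (by rw [← hrr, h]; simp)
  have hrt : r ≠ ∞ := fun h => hRtop (by rw [← hrr, h]; simp)
  rw [← hrr]
  gcongr
  rw [← hrr, ENNReal.div_le_iff (by simp) (by simp), sq] at hmain
  rw [← ENNReal.mul_le_mul_iff_left hr0 hrt]
  calc r * r ≤ A * r * 2 := hmain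
    _ = _ := by ring

theorem adaptedNorm_le (lam : (k : ℕ) → (Fin k → PontryaginDual G) → S → ℝ≥0) :
    adaptedNorm lam ≤ 2 * multiplierNorm μ lam := by
  have hmain : ∀ A ∈ {A : ℝ≥0∞ | ∀ f ∈ adaptedL1 μ S, multiplierSum lam f ≤ A * ‖f‖ₑ},
      adaptedNorm lam ≤ 2 * A := by
    intro A hA
    refine iSup_le fun k => ?_
    rw [one_div, ENNReal.rpow_inv_le_iff two_pos, ENNReal.rpow_two]
    have e1 : ∑' m : ℕ, ∑' s : S, ∑' γ' : Fin m → PontryaginDual G,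
        (∑' γ : Fin k → PontryaginDual G, (lam (k + m) (Fin.append γ γ') s : ℝ≥0∞)) ^ 2
        = ∑' q : (Σ m : ℕ, S × (Fin m → PontryaginDual G)),
          (∑' γ, (lam (k + q.1) (Fin.append γ q.2.2) q.2.1 : ℝ≥0∞)) ^ 2 := by
      rw [ENNReal.tsum_sigma']
      refine tsum_congr fun m => ?_
      rw [ENNReal.tsum_prod']
    rw [e1, ENNReal.tsum_eq_iSup_sum]
    refine iSup_le fun P => ?_
    have hlim : Filter.Tendsto (fun F : Finset (Fin k → PontryaginDual G) =>
        ∑ q ∈ P, (∑ γ ∈ F, (lam (k + q.1) (Fin.append γ q.2.2) q.2.1 : ℝ≥0∞)) ^ 2) Filter.atTop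
        (nhds (∑ q ∈ P, (∑' γ, (lam (k + q.1) (Fin.append γ q.2.2) q.2.1 : ℝ≥0∞)) ^ 2)) :=
      tendsto_finsetSum _ fun q _ => ENNReal.Tendsto.pow ENNReal.summable.hasSum
    exact le_of_tendsto' hlim fun F => sum_sq_le_of_multiplierSum_le μ hA k P F
  have h2 : adaptedNorm lam / 2 ≤ multiplierNorm μ lam := le_sInf fun A hA => by
    rw [ENNReal.div_le_iff (by simp) (by simp), mul_comm]
    exact hmain A hA
  rwa [ENNReal.div_le_iff (by simp) (by simp), mul_comm] at h2

end Lower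

end AdaptedMultiplier

theorem mainTheorem1 :
    ∃ C : ℝ≥0, 0 < C ∧
      ∀ (G : Type u) [CommGroup G] [TopologicalSpace G] [IsTopologicalGroup G] [CompactSpace G]
        [MeasurableSpace G] [BorelSpace G]
        (μ : Measure G) [μ.IsHaarMeasure] [IsProbabilityMeasure μ]
        (S : Type v) (lam : (k : ℕ) → (Fin k → PontryaginDual G) → S → ℝ≥0),
        AdaptedMultiplier.multiplierNorm μ lam ≤ (C : ℝ≥0∞) * AdaptedMultiplier.adaptedNorm lam ∧
          AdaptedMultiplier.adaptedNorm lam ≤ (C : ℝ≥0∞) * AdaptedMultiplier.multiplierNorm μ lam := by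
  refine ⟨2, two_pos, fun G _ _ _ _ _ _ μ _ _ S lam => ?_⟩
  exact ⟨AdaptedMultiplier.multiplierNorm_le μ lam, AdaptedMultiplier.adaptedNorm_le μ lam⟩
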